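/- Let $M$ be a smooth $n$-dimensional (Hausdorff) manifold without boundary, $g$ a smooth Riemannian metric on $M$ and $\nabla$ a smooth torsion-free affine connection on $M$ such that $(M,g,\nabla)$ is a statistical manifold, i.e. the cubic form $$Q(X,Y,Z)=(\nabla_X g)(Y,Z)=X\,g(Y,Z)-g(\nabla_XY,Z)-g(Y,\nabla_XZ)$$ is totally symmetric. Let $\nabla^*$ be the dual connection of $\nabla$, i.e. the smooth affine connection with $X\,g(Y,Z)=g(\nabla_XY,Z)+g(Y,\nabla^*_XZ)$ for all smooth vector fields $X,Y,Z$. Let $R(X,Y)Z=\nabla_X\nabla_YZ-\nabla_Y\nabla_XZ-\nabla_{[X,Y]}Z$ and $\mathrm{Ric}(Y,Z)=\operatorname{tr}\{X\mapsto R(X,Y)Z\}$ be the curvature and Ricci tensors of $\nabla$, and let $\mathrm{Ric}^*$ be the Ricci tensor of $\nabla^*$, defined in the same way. Suppose that $(M,g,\nabla,\nabla^*)$ is conjugate Ricci-symmetric, i.e. $\mathrm{Ric}(Y,Z)=\mathrm{Ric}^*(Y,Z)$ for all smooth vector fields $Y,Z$. Then $\nabla$ is (locally) equiaffine: its Ricci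 tensor is symmetric, $\mathrm{Ric}(Y,Z)=\mathrm{Ric}(Z,Y)$ for all smooth vector fields $Y,Z$, and every point of $M$ has an open neighbourhood $U$ carrying a parallel volume form, i.e. a smooth nowhere vanishing $n$-form $\omega$ on $U$ with $\nabla\omega=0$. -/

import Mathlib

open Bundle
open scoped Manifold ContDiff

noncomputable section

/-- Affine connections on an `n`-dimensional manifold `M`, as covariant derivatives on the tangent
bundle. On paper `(∇_X Y)(x)` is `nab Y x (X x)`. Smoothness of the connection is Mathlib's class
`CovariantDerivative.ContMDiffCovariantDerivative nab ∞`. -/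
abbrev AffineConnection (n : ℕ) (M : Type*) [TopologicalSpace M]
    [ChartedSpace (EuclideanSpace ℝ (Fin n)) M] [IsManifold (𝓡 n) ∞ M] :=
  CovariantDerivative (𝓡 n) (EuclideanSpace ℝ (Fin n)) (TangentSpace (𝓡 n) : M → Type _)

/-- Smooth vector fields on `M`. -/
abbrev SmoothVectorField (n : ℕ) (M : Type*) [TopologicalSpace M]
    [ChartedSpace (EuclideanSpace ℝ (Fin n)) M] [IsManifold (𝓡 n) ∞ M] :=
  ContMDiffSection (𝓡 n) (EuclideanSpace ℝ (Fin n)) ∞ (TangentSpace (𝓡 n) : M → Type _)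

/-- Smooth Riemannian metrics on `M`; the inner product at `x` is `g.inner x`. -/
abbrev SmoothMetric (n : ℕ) (M : Type*) [TopologicalSpace M]
    [ChartedSpace (EuclideanSpace ℝ (Fin n)) M] [IsManifold (𝓡 n) ∞ M] :=
  ContMDiffRiemannianMetric (𝓡 n) ∞ (EuclideanSpace ℝ (Fin n))
    (fun x : M ↦ TangentSpace (𝓡 n) x)

namespace AffineConnection

variable {n : ℕ} {M : Type*} [TopologicalSpace M]
  [ChartedSpace (EuclideanSpace ℝ (Fin n)) M] [IsManifold (𝓡 n) ∞ M]

/-- The cubic form `Q(X, Y, Z) = (∇_X g)(Y, Z) = X g(Y, Z) - g(∇_X Y, Z) - g(Y, ∇_X Z)`. -/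
def cubicForm (g : SmoothMetric n M) (nab : AffineConnection n M)
    (X Y Z : SmoothVectorField n M) (x : M) : ℝ :=
  mvfderiv (𝓡 n) (fun y ↦ g.inner y (Y y) (Z y)) x (X x)
    - g.inner x (nab Y x (X x)) (Z x) - g.inner x (Y x) (nab Z x (X x))

/-- `(M, g, ∇)` is a statistical manifold: `∇` is torsion-free and the cubic form `∇g` is totally
symmetric (the two transpositions below generate all permutations of the arguments). -/
structure IsStatistical (g : SmoothMetric n M) (nab : AffineConnection n M) : Prop where
  torsion_free : CovariantDerivative.torsion nab = 0
  symm_left : ∀ (X Y Z : SmoothVectorField n M) (x : M),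
    cubicForm g nab X Y Z x = cubicForm g nab Y X Z x
  symm_right : ∀ (X Y Z : SmoothVectorField n M) (x : M),
    cubicForm g nab X Y Z x = cubicForm g nab X Z Y x

/-- `∇*` is the dual connection of `∇` with respect to `g`:
`X g(Y, Z) = g(∇_X Y, Z) + g(Y, ∇*_X Z)`. -/
def IsDual (g : SmoothMetric n M) (nab nabS : AffineConnection n M) : Prop :=
  ∀ (X Y Z : SmoothVectorField n M) (x : M),
    mvfderiv (𝓡 n) (fun y ↦ g.inner y (Y y) (Z y)) x (X x)
      = g.inner x (nab Y x (X x)) (Z x) + g.inner x (Y x) (nabS Z x (X x))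

/-- The vector field `X` is differentiable at `x`. -/
abbrev IsDiffFieldAt (X : ∀ x : M, TangentSpace (𝓡 n) x) (x : M) : Prop :=
  MDifferentiableAt (𝓡 n) ((𝓡 n).prod 𝓘(ℝ, EuclideanSpace ℝ (Fin n)))
    (fun y ↦ TotalSpace.mk' (EuclideanSpace ℝ (Fin n)) y (X y)) x

/-- `∇_X ∇_Y Z - ∇_Y ∇_X Z - ∇_{[X, Y]} Z` at `x`. -/
def curvatureAux (nab : AffineConnection n M) (Z X Y : ∀ x : M, TangentSpace (𝓡 n) x) (x : M) :
    TangentSpace (𝓡 n) x :=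
  nab (fun y ↦ nab Z y (Y y)) x (X x) - nab (fun y ↦ nab Z y (X y)) x (Y x)
    - nab Z x (VectorField.mlieBracket (𝓡 n) X Y x)

theorem curvatureAux_swap (nab : AffineConnection n M) (Z X Y : ∀ x : M, TangentSpace (𝓡 n) x) (x : M) :
    curvatureAux nab Z X Y x = - curvatureAux nab Z Y X x := by
  simp only [curvatureAux]
  rw [VectorField.mlieBracket_swap]
  simp
  module

variable (nab : AffineConnection n M) [CovariantDerivative.ContMDiffCovariantDerivative nab ∞]

theorem mdifferentiableAt_nab (Z : SmoothVectorField n M) {X : ∀ x : M, TangentSpace (𝓡 n) x}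
    {x : M} (hX : IsDiffFieldAt X x) : IsDiffFieldAt (fun y ↦ nab Z y (X y)) x := by
  have h := ‹CovariantDerivative.ContMDiffCovariantDerivative nab ∞›
  have h1 := (h.contMDiff.contMDiff (σ := Z) (by
    simpa using! Z.contMDiff.contMDiffOn)).contMDiffAt (x := x) Filter.univ_mem
  exact (h1.mdifferentiableAt (by simp)).clm_bundle_apply hX

theorem tensorialAt_curvatureAux_left (Z : SmoothVectorField n M) (x : M)
    (Y : ∀ x : M, TangentSpace (𝓡 n) x) :
    TensorialAt (𝓡 n) (EuclideanSpace ℝ (Fin n)) (curvatureAux nab Z · Y x) x where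
  smul {f X} hf hX := by
    have e : (fun y ↦ nab Z y ((f • X) y)) = f • (fun y ↦ nab Z y (X y)) := by
      ext1 y; simp
    simp only [curvatureAux, e, VectorField.mlieBracket_smul_left hf hX,
      nab.isCovariantDerivativeOn.leibniz (mdifferentiableAt_nab nab Z hX) hf]
    simp
    module
  add {X X'} hX hX' := by
    have e : (fun y ↦ nab Z y ((X + X') y)) =
        (fun y ↦ nab Z y (X y)) + (fun y ↦ nab Z y (X' y)) := by
      ext1 y; simp
    simp only [curvatureAux, e, VectorField.mlieBracket_add_left hX hX',
      nab.isCovariantDerivativeOn.add (mdifferentiableAt_nab nab Z hX)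
        (mdifferentiableAt_nab nab Z hX')]
    simp
    module

theorem tensorialAt_curvatureAux_right (Z : SmoothVectorField n M) (x : M)
    (X : ∀ x : M, TangentSpace (𝓡 n) x) :
    TensorialAt (𝓡 n) (EuclideanSpace ℝ (Fin n)) (curvatureAux nab Z X · x) x where
  smul hf hY := by
    simp only [curvatureAux_swap nab Z X,
      (tensorialAt_curvatureAux_left nab Z x X).smul hf hY, smul_neg]
  add hY hY' := by
    simp only [curvatureAux_swap nab Z X,
      (tensorialAt_curvatureAux_left nab Z x X).add hY hY', neg_add]

/-- The curvature `(u, v) ↦ R(u, v)Z` at `x`, for tangent vectors `u`, `v` at `x` and a smooth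
vector field `Z`. -/
def curvature (Z : SmoothVectorField n M) (x : M) :
    TangentSpace (𝓡 n) x →L[ℝ] TangentSpace (𝓡 n) x →L[ℝ] TangentSpace (𝓡 n) x :=
  TensorialAt.mkHom₂ (fun X Y ↦ curvatureAux nab Z X Y x) x
    (fun Y _ ↦ tensorialAt_curvatureAux_left nab Z x Y)
    (fun X _ ↦ tensorialAt_curvatureAux_right nab Z x X)

/-- `R(X, Y)Z = ∇_X ∇_Y Z - ∇_Y ∇_X Z - ∇_{[X, Y]} Z`. -/
theorem curvature_apply (Z : SmoothVectorField n M) {x : M}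
    {X Y : ∀ x : M, TangentSpace (𝓡 n) x} (hX : IsDiffFieldAt X x) (hY : IsDiffFieldAt Y x) :
    curvature nab Z x (X x) (Y x) =
      nab (fun y ↦ nab Z y (Y y)) x (X x) - nab (fun y ↦ nab Z y (X y)) x (Y x)
        - nab Z x (VectorField.mlieBracket (𝓡 n) X Y x) :=
  TensorialAt.mkHom₂_apply _ _ hX hY

/-- The Ricci tensor `Ric(Y, Z) = tr (u ↦ R(u, Y)Z)` at `x`. -/
def ricci (Y Z : SmoothVectorField n M) (x : M) : ℝ :=
  LinearMap.trace ℝ (TangentSpace (𝓡 n) x)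
    ((ContinuousLinearMap.coeLM ℝ ∘ₗ (curvature nab Z x).toLinearMap).flip (Y x))

/-- The Ricci tensor of `∇` is symmetric. -/
def IsRicciSymmetric : Prop :=
  ∀ (Y Z : SmoothVectorField n M) (x : M), ricci nab Y Z x = ricci nab Z Y x

/-- Conjugate Ricci-symmetry of the pair `(∇, ∇*)`: `Ric(Y, Z) = Ric*(Y, Z)`. -/
def IsConjugateRicciSymmetric (nabS : AffineConnection n M)
    [CovariantDerivative.ContMDiffCovariantDerivative nabS ∞] : Prop :=
  ∀ (Y Z : SmoothVectorField n M) (x : M), ricci nab Y Z x = ricci nabS Y Z x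

end AffineConnection

section VolumeForm

variable {n : ℕ} {M : Type*} [TopologicalSpace M]
  [ChartedSpace (EuclideanSpace ℝ (Fin n)) M] [IsManifold (𝓡 n) ∞ M]

/-- The vector field `X` is smooth on `U`. -/
abbrev IsSmoothFieldOn (U : Set M) (X : ∀ x : M, TangentSpace (𝓡 n) x) : Prop :=
  ContMDiffOn (𝓡 n) ((𝓡 n).prod 𝓘(ℝ, EuclideanSpace ℝ (Fin n))) ∞
    (fun y ↦ TotalSpace.mk' (EuclideanSpace ℝ (Fin n)) y (X y)) U

/-- `vol` is a volume form on the open set `U`: a smooth `n`-form, i.e. `vol(Y₁, …, Yₙ)` is smooth on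
`U` for all vector fields `Yᵢ` that are smooth on `U`, which vanishes nowhere on `U`.
The values of `vol` outside `U` are irrelevant. -/
structure IsVolumeFormOn (U : Set M) (vol : ∀ x : M, TangentSpace (𝓡 n) x [⋀^Fin n]→ₗ[ℝ] ℝ) :
    Prop where
  smooth : ∀ Y : Fin n → ∀ x : M, TangentSpace (𝓡 n) x, (∀ i, IsSmoothFieldOn U (Y i)) →
    ContMDiffOn (𝓡 n) 𝓘(ℝ, ℝ) ∞ (fun x ↦ vol x (fun i ↦ Y i x)) U
  ne_zero : ∀ x ∈ U, vol x ≠ 0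

namespace AffineConnection

/-- `(∇_v vol)(Y₁, …, Yₙ) = v (vol(Y₁, …, Yₙ)) - ∑ᵢ vol(Y₁, …, ∇_v Yᵢ, …, Yₙ)` for a tangent vector `v`
at `x`. -/
def covDerivForm (nab : AffineConnection n M)
    (vol : ∀ x : M, TangentSpace (𝓡 n) x [⋀^Fin n]→ₗ[ℝ] ℝ)
    (Y : Fin n → ∀ x : M, TangentSpace (𝓡 n) x) (x : M) (v : TangentSpace (𝓡 n) x) : ℝ :=
  mvfderiv (𝓡 n) (fun y ↦ vol y (fun i ↦ Y i y)) x v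
    - ∑ i, vol x (Function.update (fun j ↦ Y j x) i (nab (Y i) x v))

/-- `∇vol = 0` on the open set `U`. -/
def IsParallelOn (nab : AffineConnection n M) (U : Set M)
    (vol : ∀ x : M, TangentSpace (𝓡 n) x [⋀^Fin n]→ₗ[ℝ] ℝ) : Prop :=
  ∀ Y : Fin n → ∀ x : M, TangentSpace (𝓡 n) x, (∀ i, IsSmoothFieldOn U (Y i)) →
    ∀ x ∈ U, ∀ v : TangentSpace (𝓡 n) x, covDerivForm nab vol Y x v = 0

/-- `∇` is a (locally) equiaffine connection: every point has an open neighbourhood that carries a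
parallel volume form. -/
def IsEquiaffine (nab : AffineConnection n M) : Prop :=
  ∀ p : M, ∃ U : Set M, IsOpen U ∧ p ∈ U ∧
    ∃ vol : ∀ x : M, TangentSpace (𝓡 n) x [⋀^Fin n]→ₗ[ℝ] ℝ,
      IsVolumeFormOn U vol ∧ IsParallelOn nab U vol

end AffineConnection

end VolumeForm

end

/-! ### Global smooth fields and coordinate frames. -/

noncomputable section

variable {n : ℕ} {M : Type*} [TopologicalSpace M]
  [ChartedSpace (EuclideanSpace ℝ (Fin n)) M] [IsManifold (𝓡 n) ∞ M]

/-! Differentiating g(Z, W) twice with the duality relation gives g(R(X,Y)Z, W) = -g(Z, R*(X,Y)W)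
(`IsDual.inner_curvature`), so tr R(Y,Z) = -tr R*(Y,Z). Total symmetry of the cubic form makes ∇*
torsion-free as well (`IsStatistical.isTorsionFree_dual`). For a torsion-free connection the first
Bianchi identity yields Ric(Y,Z) - Ric(Z,Y) = -tr R(Y,Z) (`IsTorsionFree.ricci_sub_ricci`). Hence
the skew parts of Ric and Ric* are opposite; since Ric = Ric*, they vanish.

For the volume form, let τ(v) be the trace of ∂ᵢ ↦ ∇_v ∂ᵢ in a coordinate frame (`traceForm`). Then
tr R = dτ (`trace_curvature_eq`), so symmetry of Ric makes τ closed. The Poincaré lemma gives a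
local f with df = τ, and e^f dx₁ ∧ ⋯ ∧ dxₙ is parallel because its covariant derivative is (df - τ)
times itself (`isParallelOn_coordVol`). -/

theorem isManifold_minSmoothness {m : ℕ∞ω} (hm : m ≤ ∞) :
    IsManifold (𝓡 n) (minSmoothness ℝ m) M := by
  rw [minSmoothness_of_isRCLikeNormedField]
  exact IsManifold.of_le hm

namespace AffineConnection

/-- The smooth vector field `∇_X Z`. -/
def covField (nab : AffineConnection n M) [CovariantDerivative.ContMDiffCovariantDerivative nab ∞]
    (X Z : SmoothVectorField n M) : SmoothVectorField n M where
  toFun y := nab Z y (X y)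
  contMDiff_toFun := by
    have h := ‹CovariantDerivative.ContMDiffCovariantDerivative nab ∞›
    have h1 := contMDiffOn_univ.1 (h.contMDiff.contMDiff (σ := Z) (by
      simpa using! Z.contMDiff.contMDiffOn))
    exact h1.clm_bundle_apply X.contMDiff

@[simp]
theorem covField_apply (nab : AffineConnection n M)
    [CovariantDerivative.ContMDiffCovariantDerivative nab ∞]
    (X Z : SmoothVectorField n M) (x : M) : covField nab X Z x = nab Z x (X x) := rfl

end AffineConnection

namespace SmoothVectorField

/-- The Lie bracket of two smooth vector fields. -/
def bracket (X Y : SmoothVectorField n M) : SmoothVectorField n M where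
  toFun := VectorField.mlieBracket (𝓡 n) X Y
  contMDiff_toFun := by
    have := isManifold_minSmoothness (n := n) (M := M) (m := 2) ENat.LEInfty.out
    -- ∞ + 1 reduces to ∞, so the bracket of smooth fields loses no regularity.
    have : IsManifold (𝓡 n) ((⊤ : ℕ∞) + 1) M := ‹IsManifold (𝓡 n) ∞ M›
    exact ContDiff.mlieBracket_vectorField (n := ⊤) (m := ⊤) X.contMDiff Y.contMDiff (by simp)

@[simp]
theorem bracket_apply (X Y : SmoothVectorField n M) (x : M) :
    bracket X Y x = VectorField.mlieBracket (𝓡 n) X Y x := rfl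

end SmoothVectorField

/-- The trivialization of the tangent bundle given by the chart at `p`. -/
abbrev chartTriv (p : M) :
    Trivialization (EuclideanSpace ℝ (Fin n))
      (TotalSpace.proj : TotalSpace (EuclideanSpace ℝ (Fin n)) (TangentSpace (𝓡 n) : M → Type _) → M) :=
  trivializationAt (EuclideanSpace ℝ (Fin n)) (TangentSpace (𝓡 n)) p

/-- The coordinate frame of the chart at `p`. -/
abbrev coordFrame (p : M) (i : Fin n) (x : M) : TangentSpace (𝓡 n) x :=
  (chartTriv p).localFrame (EuclideanSpace.basisFun (Fin n) ℝ).toBasis i x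

/-- Coefficients of a tangent vector in the coordinate frame of the chart at `p`. -/
abbrev coordCoeff (p : M) (i : Fin n) (x : M) : TangentSpace (𝓡 n) x →ₗ[ℝ] ℝ :=
  (chartTriv p).localFrameCoeff (𝓡 n) (EuclideanSpace.basisFun (Fin n) ℝ).toBasis i x

/-- Curvature and Ricci accept only global smooth fields. Multiplying the coordinate frame by a bump
function at `p` makes it global without changing it where the bump equals 1. -/
theorem exists_smoothVectorField_eq_coordFrame [T2Space M] (p : M) :
    ∃ V : Set M, IsOpen V ∧ p ∈ V ∧ V ⊆ (chartAt (EuclideanSpace ℝ (Fin n)) p).source ∧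
      ∃ F : Fin n → SmoothVectorField n M, ∀ i, ∀ x ∈ V, F i x = coordFrame p i x := by
  have f : SmoothBumpFunction (𝓡 n) p := Classical.arbitrary _
  have h1 : ∀ᶠ x in nhds p, f x = 1 := f.eventuallyEq_one
  obtain ⟨V, hV, hVo, hpV⟩ := eventually_nhds_iff.1 h1
  refine ⟨V ∩ (chartAt (EuclideanSpace ℝ (Fin n)) p).source,
    hVo.inter (chartAt _ p).open_source, ⟨hpV, mem_chart_source _ p⟩, Set.inter_subset_right,
    fun i ↦ ⟨fun x ↦ f x • coordFrame p i x, ?_⟩, ?_⟩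
  · exact ContMDiffOn.smul_section_of_tsupport (f.contMDiff.contMDiffOn)
      (chartTriv p).open_baseSet f.tsupport_subset_chartAt_source
      ((chartTriv p).contMDiffOn_localFrame_baseSet ∞ _ i)
  · rintro i x ⟨hx, -⟩
    change f x • coordFrame p i x = _
    rw [hV x hx, one_smul]

theorem coordFrame_linearCombination {p x : M}
    (hx : x ∈ (chartAt (EuclideanSpace ℝ (Fin n)) p).source) (v : TangentSpace (𝓡 n) x) :
    v = ∑ i, coordCoeff p i x v • coordFrame p i x := by
  classical
  -- The frame expansion is stated for sections; `v` is extended by zero, and only the value at `x`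
  -- matters.
  simpa using (chartTriv p).eq_sum_localFrameCoeff_smul (I := 𝓡 n)
    (b := (EuclideanSpace.basisFun (Fin n) ℝ).toBasis) (s := Function.update 0 x v) hx

theorem exists_smoothVectorField_apply_eq [T2Space M] {x : M} (v : TangentSpace (𝓡 n) x) :
    ∃ X : SmoothVectorField n M, X x = v := by
  obtain ⟨V, -, hxV, hV, F, hF⟩ := exists_smoothVectorField_eq_coordFrame (n := n) x
  refine ⟨∑ i, coordCoeff x i x v • F i, ?_⟩
  have := congrFun (map_sum (ContMDiffSection.coeAddHom (𝓡 n) (EuclideanSpace ℝ (Fin n)) ∞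
    (TangentSpace (𝓡 n) : M → Type _)) (fun i ↦ coordCoeff x i x v • F i) Finset.univ) x
  simp only [ContMDiffSection.coeAddHom_apply, Finset.sum_apply] at this
  rw [this, coordFrame_linearCombination (hV hxV) v]
  simp only [ContMDiffSection.coe_smul, Pi.smul_apply, hF _ x hxV,
    ← coordFrame_linearCombination (hV hxV) v]

end

/-! ### Jacobi identity and the bracket as a commutator of derivations. -/

noncomputable section

variable {n : ℕ} {M : Type*} [TopologicalSpace M]
  [ChartedSpace (EuclideanSpace ℝ (Fin n)) M] [IsManifold (𝓡 n) ∞ M]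

namespace SmoothVectorField

/-- The Jacobi identity. -/
theorem jacobi (X Y Z : SmoothVectorField n M) :
    bracket X (bracket Y Z) = bracket (bracket X Y) Z + bracket Y (bracket X Z) := by
  have := isManifold_minSmoothness (n := n) (M := M) (m := 3) ENat.LEInfty.out
  have h (W : SmoothVectorField n M) := W.contMDiff.of_le
    (show minSmoothness ℝ 2 ≤ ∞ by simpa using ENat.LEInfty.out)
  exact ContMDiffSection.coe_inj (VectorField.leibniz_identity_mlieBracket (h X) (h Y) (h Z))

/-- `[X, Y] f = X (Y f) - Y (X f)`. -/
theorem mvfderiv_bracket [T2Space M] {f : M → ℝ} (hf : ContMDiff (𝓡 n) 𝓘(ℝ, ℝ) ∞ f)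
    (X Y : SmoothVectorField n M) {x : M}
    (hX : MDifferentiableAt (𝓡 n) 𝓘(ℝ, ℝ) (fun y ↦ mvfderiv (𝓡 n) f y (X y)) x)
    (hY : MDifferentiableAt (𝓡 n) 𝓘(ℝ, ℝ) (fun y ↦ mvfderiv (𝓡 n) f y (Y y)) x) :
    mvfderiv (𝓡 n) f x (bracket X Y x) =
      mvfderiv (𝓡 n) (fun y ↦ mvfderiv (𝓡 n) f y (Y y)) x (X x)
        - mvfderiv (𝓡 n) (fun y ↦ mvfderiv (𝓡 n) f y (X y)) x (Y x) := by
  -- The scalar identity will be read off as the coefficient of a nonzero vector, which does not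
  -- exist when n = 0.
  rcases subsingleton_or_nontrivial (TangentSpace (𝓡 n) x) with hs | hs
  · rw [Subsingleton.elim (X x) 0, Subsingleton.elim (Y x) 0, Subsingleton.elim (bracket X Y x) 0]
    simp
  have : IsManifold (𝓡 n) 2 M := IsManifold.of_le (n := ∞) ENat.LEInfty.out
  obtain ⟨v, hv⟩ := exists_ne (0 : TangentSpace (𝓡 n) x)
  obtain ⟨Z, rfl⟩ := exists_smoothVectorField_apply_eq v
  have hfd (y : M) : MDifferentiableAt (𝓡 n) 𝓘(ℝ, ℝ) f y := (hf y).mdifferentiableAt (by simp)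
  -- Expand the Jacobi identity for X, Y, fZ by the Leibniz rule. The cross terms cancel, f times
  -- the identity for X, Y, Z drops out, and ([X,Y]f - X(Yf) + Y(Xf)) Z = 0 remains.
  let fZ : SmoothVectorField n M := ⟨f • ⇑Z, hf.smul_section Z.contMDiff⟩
  have leib (W : SmoothVectorField n M) : ⇑(bracket W fZ) =
      (fun y ↦ mvfderiv (𝓡 n) f y (W y)) • ⇑Z + f • ⇑(bracket W Z) := by
    ext1 y
    exact VectorField.mlieBracket_smul_right (V := W) (hfd y) Z.mdifferentiableAt
  have leib₂ (V W : SmoothVectorField n M)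
      (hW : MDifferentiableAt (𝓡 n) 𝓘(ℝ, ℝ) (fun y ↦ mvfderiv (𝓡 n) f y (W y)) x) :
      bracket V (bracket W fZ) x =
        (mvfderiv (𝓡 n) (fun y ↦ mvfderiv (𝓡 n) f y (W y)) x (V x) • Z x
          + mvfderiv (𝓡 n) f x (W x) • bracket V Z x)
        + (mvfderiv (𝓡 n) f x (V x) • bracket W Z x + f x • bracket V (bracket W Z) x) := by
    rw [bracket_apply, leib W, VectorField.mlieBracket_add_right,
      VectorField.mlieBracket_smul_right hW Z.mdifferentiableAt,
      VectorField.mlieBracket_smul_right (hfd x) (bracket W Z).mdifferentiableAt]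
    · rfl
    · exact hW.smul_section Z.mdifferentiableAt
    · exact (hfd x).smul_section (bracket W Z).mdifferentiableAt
  have h₁ := congrArg (fun W : SmoothVectorField n M ↦ W x) (jacobi X Y fZ)
  have h₂ := congrArg (fun W : SmoothVectorField n M ↦ W x) (jacobi X Y Z)
  simp only [ContMDiffSection.coe_add, Pi.add_apply] at h₁ h₂
  rw [leib₂ X Y hY, leib₂ Y X hX, leib (bracket X Y), h₂] at h₁
  simp only [Pi.add_apply, Pi.smul_apply'] at h₁
  refine smul_left_injective ℝ hv ?_
  simp only [sub_smul]
  rw [smul_add] at h₁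
  linear_combination (norm := module) -h₁

end SmoothVectorField

/-! ### Duality, Bianchi identity and symmetry of the Ricci tensor. -/

namespace AffineConnection

open SmoothVectorField

variable (nab nabS : AffineConnection n M)

/-- `∇_X Y - ∇_Y X = [X, Y]` for smooth vector fields. -/
def IsTorsionFree : Prop :=
  ∀ (X Y : SmoothVectorField n M) (x : M), nab Y x (X x) - nab X x (Y x) = bracket X Y x

theorem isTorsionFree_of_torsion_eq_zero (h : CovariantDerivative.torsion nab = 0) :
    nab.IsTorsionFree := fun X Y _ ↦
  nab.torsion_eq_zero_iff.1 h X.mdifferentiableAt Y.mdifferentiableAt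

variable {nab nabS} {g : SmoothMetric n M}

theorem eq_of_forall_inner_eq [T2Space M] {x : M} {v w : TangentSpace (𝓡 n) x}
    (h : ∀ Y : SmoothVectorField n M, g.inner x (Y x) v = g.inner x (Y x) w) : v = w := by
  obtain ⟨Y, hY⟩ := exists_smoothVectorField_apply_eq (v - w)
  by_contra hne
  have := g.pos x (v - w) (sub_ne_zero.2 hne)
  have h' := h Y
  rw [hY] at h'
  rw [map_sub, h', sub_self] at this
  exact lt_irrefl _ this

/-- The dual connection of a statistical structure is torsion-free. -/
theorem IsStatistical.isTorsionFree_dual [T2Space M] (h : IsStatistical g nab)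
    (hd : IsDual g nab nabS) : nabS.IsTorsionFree := by
  intro X Z x
  refine eq_of_forall_inner_eq (g := g) fun Y ↦ ?_
  have ht := isTorsionFree_of_torsion_eq_zero nab h.torsion_free X Z x
  -- By duality Q(X,Y,Z) = g(Y, ∇*_X Z - ∇_X Z), so exchanging X and Z shows that ∇* - ∇ is
  -- symmetric and both torsions agree.
  have e : cubicForm g nab X Y Z x = cubicForm g nab Z Y X x := by
    rw [h.symm_right X, h.symm_left X, h.symm_right Z]
  simp only [cubicForm, hd X Y Z x, hd Z Y X x] at e
  rw [← ht, map_sub, map_sub]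
  linarith

theorem nab_sub (X Y : SmoothVectorField n M) (x : M) : nab ⇑(X - Y) x = nab X x - nab Y x := by
  have := nab.isCovariantDerivativeOn.add (s := Set.univ) (x := x)
    (X - Y).mdifferentiableAt Y.mdifferentiableAt
  rw [eq_sub_iff_add_eq, ← this]
  congr 1
  ext1 y
  simp

variable [CovariantDerivative.ContMDiffCovariantDerivative nab ∞]
  [CovariantDerivative.ContMDiffCovariantDerivative nabS ∞]

theorem curvature_eq (X Y Z : SmoothVectorField n M) (x : M) :
    curvature nab Z x (X x) (Y x) = covField nab X (covField nab Y Z) x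
      - covField nab Y (covField nab X Z) x - covField nab (bracket X Y) Z x :=
  curvature_apply nab Z X.mdifferentiableAt Y.mdifferentiableAt

/-- The first Bianchi identity. -/
theorem IsTorsionFree.bianchi (h : nab.IsTorsionFree) (X Y Z : SmoothVectorField n M) (x : M) :
    curvature nab Z x (X x) (Y x) + curvature nab X x (Y x) (Z x)
      + curvature nab Y x (Z x) (X x) = 0 := by
  have e (A B : SmoothVectorField n M) : covField nab A B - covField nab B A = bracket A B :=
    ContMDiffSection.ext fun y ↦ h A B y
  -- Both sides are ∇_A [B,C] - ∇_{[B,C]} A, by vanishing torsion; the cyclic sum turns Bianchi into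
  -- Jacobi.
  have key (A B C : SmoothVectorField n M) :
      covField nab A (covField nab B C) x - covField nab A (covField nab C B) x
        - covField nab (bracket B C) A x = bracket A (bracket B C) x := by
    rw [← h A (bracket B C) x, ← e B C]
    simp only [covField_apply, nab_sub]
    simp
  have j := congrArg (fun W : SmoothVectorField n M ↦ W x) (jacobi X Y Z)
  have s₁ : bracket (bracket X Y) Z x = - bracket Z (bracket X Y) x :=
    VectorField.mlieBracket_swap_apply
  have s₂ : bracket X Z = - bracket Z X :=
    ContMDiffSection.coe_inj VectorField.mlieBracket_swap
  have s₃ : bracket Y (-bracket Z X) x = - bracket Y (bracket Z X) x := by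
    have : IsManifold (𝓡 n) 2 M := IsManifold.of_le (n := ∞) ENat.LEInfty.out
    have := VectorField.mlieBracket_const_smul_right (I := 𝓡 n) (c := (-1 : ℝ)) (V := Y)
      (W := bracket Z X) (x := x) (bracket Z X).mdifferentiableAt
    simpa using this
  simp only [ContMDiffSection.coe_add, Pi.add_apply] at j
  rw [s₁, s₂, s₃, ← key X Y Z, ← key Y Z X, ← key Z X Y] at j
  rw [curvature_eq, curvature_eq, curvature_eq]
  linear_combination (norm := module) j

theorem contMDiff_inner (g : SmoothMetric n M) (Y Z : SmoothVectorField n M) :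
    ContMDiff (𝓡 n) 𝓘(ℝ, ℝ) ∞ (fun y ↦ g.inner y (Y y) (Z y)) := by
  let : RiemannianBundle (fun x : M ↦ TangentSpace (𝓡 n) x) := ⟨g.toRiemannianMetric⟩
  exact ContMDiff.inner_bundle (F := EuclideanSpace ℝ (Fin n))
    (E := fun x : M ↦ TangentSpace (𝓡 n) x) Y.contMDiff Z.contMDiff

/-- `g(R(X, Y)Z, W) = - g(Z, R*(X, Y)W)`. -/
theorem IsDual.inner_curvature [T2Space M] (hd : IsDual g nab nabS)
    (X Y Z W : SmoothVectorField n M) (x : M) :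
    g.inner x (curvature nab Z x (X x) (Y x)) (W x) =
      - g.inner x (Z x) (curvature nabS W x (X x) (Y x)) := by
  have hmd (A B : SmoothVectorField n M) :
      MDifferentiableAt (𝓡 n) 𝓘(ℝ, ℝ) (fun y ↦ g.inner y (A y) (B y)) x :=
    (contMDiff_inner g A B x).mdifferentiableAt (by simp)
  have d₁ (A : SmoothVectorField n M) :
      (fun y ↦ mvfderiv (𝓡 n) (fun y ↦ g.inner y (Z y) (W y)) y (A y)) =
      (fun y ↦ g.inner y (covField nab A Z y) (W y)) +
        (fun y ↦ g.inner y (Z y) (covField nabS A W y)) := funext fun y ↦ hd A Z W y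
  -- In X(Y g(Z,W)) the mixed terms g(∇_Y Z, ∇*_X W) + g(∇_X Z, ∇*_Y W) are symmetric in X, Y, so
  -- the commutator leaves only curvature terms.
  have h := mvfderiv_bracket (contMDiff_inner g Z W) X Y (x := x)
    (by rw [d₁]; exact (hmd _ _).add (hmd _ _)) (by rw [d₁]; exact (hmd _ _).add (hmd _ _))
  rw [d₁, d₁, mvfderiv_add (hmd _ _) (hmd _ _), mvfderiv_add (hmd _ _) (hmd _ _), hd] at h
  rw [add_apply, add_apply, hd X (covField nab Y Z) W, hd Y (covField nab X Z) W,
    hd X Z (covField nabS Y W), hd Y Z (covField nabS X W)] at h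
  rw [curvature_eq, curvature_eq]
  simp only [map_sub, sub_apply, covField_apply] at h ⊢
  linarith

/-- `Ric(Y, Z) - Ric(Z, Y) = - tr R(Y, Z)`. -/
theorem IsTorsionFree.ricci_sub_ricci (h : nab.IsTorsionFree) (Y Z : SmoothVectorField n M) {x : M}
    {ι : Type*} [Fintype ι] (b : Module.Basis ι ℝ (TangentSpace (𝓡 n) x))
    (F : ι → SmoothVectorField n M)
    (hF : ∀ i, F i x = b i) :
    ricci nab Y Z x - ricci nab Z Y x = - ∑ i, b.repr (curvature nab (F i) x (Y x) (Z x)) i := by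
  classical
  have tr (A B : SmoothVectorField n M) :
      ricci nab A B x = ∑ i, b.repr (curvature nab B x (F i x) (A x)) i := by
    rw [ricci, LinearMap.trace_eq_matrix_trace ℝ b]
    simp [Matrix.trace, LinearMap.toMatrix_apply, hF]
  rw [tr, tr, ← Finset.sum_sub_distrib, ← Finset.sum_neg_distrib]
  refine Finset.sum_congr rfl fun i _ ↦ ?_
  have hb := h.bianchi (F i) Y Z x
  have hs : curvature nab Y x (Z x) (F i x) = - curvature nab Y x (F i x) (Z x) := by
    rw [curvature_eq, curvature_eq]
    exact curvatureAux_swap nab Y Z (F i) x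
  rw [hs] at hb
  have := congrArg (fun v ↦ b.repr v i) hb
  simp only [map_add, map_neg, map_zero, Finsupp.add_apply, Finsupp.neg_apply,
    Finsupp.zero_apply] at this
  linarith

/-- Diagonal entries of an endomorphism can be read off the metric up to the factor g(bᵢ, bᵢ). This
positive factor cancels when two traces are compared, so no normalization is needed. -/
theorem exists_orthogonal_basis_metric (g : SmoothMetric n M) (x : M) :
    ∃ b : Module.Basis (Fin (Module.finrank ℝ (TangentSpace (𝓡 n) x))) ℝ (TangentSpace (𝓡 n) x),
      ∀ v i, g.inner x v (b i) = b.repr v i * g.inner x (b i) (b i) := by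
  let B : LinearMap.BilinForm ℝ (TangentSpace (𝓡 n) x) :=
    ContinuousLinearMap.coeLM ℝ ∘ₗ (g.inner x).toLinearMap
  have hB : LinearMap.IsSymm B := ⟨fun v w ↦ g.symm x v w⟩
  have : FiniteDimensional ℝ (TangentSpace (𝓡 n) x) :=
    inferInstanceAs (FiniteDimensional ℝ (EuclideanSpace ℝ (Fin n)))
  obtain ⟨b, hb⟩ := LinearMap.BilinForm.exists_orthogonal_basis (B := B) hB
  refine ⟨b, fun v i ↦ ?_⟩
  have ho : ∀ j, j ≠ i → g.inner x (b j) (b i) = 0 := fun j hj ↦ hb hj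
  conv_lhs => rw [← b.sum_repr v]
  simp only [map_sum, map_smul, sum_apply, smul_apply, smul_eq_mul]
  rw [Finset.sum_eq_single i (fun j _ hj ↦ by rw [ho j hj, mul_zero]) (by simp)]

theorem IsConjugateRicciSymmetric.isRicciSymmetric [T2Space M]
    (hRic : IsConjugateRicciSymmetric nab nabS) (h : nab.IsTorsionFree) (hS : nabS.IsTorsionFree)
    (hd : IsDual g nab nabS) : IsRicciSymmetric nab := by
  intro Y Z x
  obtain ⟨b, hb⟩ := exists_orthogonal_basis_metric g x
  choose F hF using fun i ↦ exists_smoothVectorField_apply_eq (b i)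
  have h₁ := h.ricci_sub_ricci Y Z b F hF
  have h₂ := hS.ricci_sub_ricci Y Z b F hF
  rw [← hRic Y Z x, ← hRic Z Y x] at h₂
  -- Taking both arguments of the duality relation equal to bᵢ makes the diagonal entries of R and
  -- R* opposite.
  have h₃ : ∀ i, b.repr (curvature nab (F i) x (Y x) (Z x)) i =
      - b.repr (curvature nabS (F i) x (Y x) (Z x)) i := by
    intro i
    have hpos := g.pos x (b i) (b.ne_zero i)
    have := hd.inner_curvature Y Z (F i) (F i) x
    rw [g.symm x (F i x), hF, hb (curvature nab _ _ _ _), hb (curvature nabS _ _ _ _)] at this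
    exact mul_right_cancel₀ hpos.ne' (by linarith)
  simp only [h₃, Finset.sum_neg_distrib] at h₁
  linarith

end AffineConnection

end

/-! ### Coordinate calculus and the trace form of the connection. -/

noncomputable section

theorem mvfderiv_fun_sum {n : ℕ} {M : Type*} [TopologicalSpace M]
    [ChartedSpace (EuclideanSpace ℝ (Fin n)) M] {ι : Type} {s : Finset ι} {f : ι → M → ℝ} {x : M}
    (hf : ∀ i ∈ s, MDifferentiableAt (𝓡 n) 𝓘(ℝ, ℝ) (f i) x) :
    mvfderiv (𝓡 n) (fun y ↦ ∑ i ∈ s, f i y) x = ∑ i ∈ s, mvfderiv (𝓡 n) (f i) x := by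
  classical
  induction s using Finset.induction_on with
  | empty => simpa using mvfderiv_const (0 : ℝ)
  | insert a s ha ih =>
    have h₁ : MDifferentiableAt (𝓡 n) 𝓘(ℝ, ℝ) (fun y ↦ ∑ i ∈ s, f i y) x := by
      have := MDifferentiableAt.sum (I := 𝓡 n) (t := s) (f := f) (z := x)
        fun i hi ↦ hf i (Finset.mem_insert_of_mem hi)
      rwa [Finset.sum_fn] at this
    simp only [Finset.sum_insert ha]
    rw [mvfderiv_fun_add (hf a (Finset.mem_insert_self a s)) h₁,
      ih fun i hi ↦ hf i (Finset.mem_insert_of_mem hi)]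

variable {n : ℕ} {M : Type*} [TopologicalSpace M]
  [ChartedSpace (EuclideanSpace ℝ (Fin n)) M] [IsManifold (𝓡 n) ∞ M]

section CoordFrame

variable {p x : M}

theorem coordCoeff_coordFrame (hx : x ∈ (chartAt (EuclideanSpace ℝ (Fin n)) p).source)
    (i j : Fin n) : coordCoeff p i x (coordFrame p j x) = if i = j then 1 else 0 := by
  have hx' : x ∈ (chartTriv (n := n) p).baseSet := hx
  have h := (chartTriv p).localFrameCoeff_apply_of_mem_baseSet (I := 𝓡 n)
    (b := (EuclideanSpace.basisFun (Fin n) ℝ).toBasis) hx' (coordFrame p j) i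
  rw [coordCoeff, h, coordFrame, Trivialization.localFrame_apply_of_mem_baseSet _ _ hx',
    Module.Basis.repr_self, Finsupp.single_apply]
  simp [eq_comm]

/-- The tangent bundle trivialization at `p` acts on fibres as the derivative of the chart, so the
frame it defines consists of the coordinate fields ∂ᵢ. -/
theorem mfderiv_extChartAt_coordFrame (hx : x ∈ (chartAt (EuclideanSpace ℝ (Fin n)) p).source)
    (i : Fin n) :
    mfderiv (𝓡 n) 𝓘(ℝ, EuclideanSpace ℝ (Fin n)) (extChartAt (𝓡 n) p) x (coordFrame p i x) =
      EuclideanSpace.basisFun (Fin n) ℝ i := by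
  have hx' : x ∈ (chartTriv (n := n) p).baseSet := hx
  have key : (chartTriv p).continuousLinearMapAt ℝ x (coordFrame p i x) =
      EuclideanSpace.basisFun (Fin n) ℝ i := by
    rw [coordFrame, Trivialization.localFrame_apply_of_mem_baseSet _ _ hx', Trivialization.basisAt,
      Trivialization.continuousLinearMapAt_apply, Trivialization.linearMapAt_def_of_mem _ hx']
    exact (((chartTriv p).linearEquivAt ℝ x hx').apply_symm_apply _).trans (by simp)
  have : IsManifold (𝓡 n) 1 M := IsManifold.of_le (n := ∞) ENat.LEInfty.out
  have h := TangentBundle.continuousLinearMapAt_trivializationAt (I := 𝓡 n) (x₀ := p) (x := x) hx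
  exact (congrArg (fun L : TangentSpace (𝓡 n) x →L[ℝ] EuclideanSpace ℝ (Fin n) ↦
    L (coordFrame p i x)) h).symm.trans key

theorem mfderiv_extChartAt_apply (hx : x ∈ (chartAt (EuclideanSpace ℝ (Fin n)) p).source)
    (v : TangentSpace (𝓡 n) x) :
    mfderiv (𝓡 n) 𝓘(ℝ, EuclideanSpace ℝ (Fin n)) (extChartAt (𝓡 n) p) x v =
      ∑ i, coordCoeff p i x v • EuclideanSpace.basisFun (Fin n) ℝ i := by
  conv_lhs => rw [coordFrame_linearCombination hx v]
  rw [map_sum]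
  refine Finset.sum_congr rfl fun i _ ↦ ?_
  rw [map_smul, mfderiv_extChartAt_coordFrame hx]
  rfl

/-- The constant vector field `v` on `ℝⁿ`. -/
def constField (v : EuclideanSpace ℝ (Fin n)) (z : EuclideanSpace ℝ (Fin n)) :
    TangentSpace 𝓘(ℝ, EuclideanSpace ℝ (Fin n)) z := v

theorem mlieBracket_constField (v w z : EuclideanSpace ℝ (Fin n)) :
    VectorField.mlieBracket 𝓘(ℝ, EuclideanSpace ℝ (Fin n)) (constField v) (constField w) z = 0 := by
  have h := congrFun (VectorField.mlieBracketWithin_eq_lieBracketWithin (𝕜 := ℝ)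
    (V := constField v) (W := constField w) (s := Set.univ)) z
  rw [VectorField.mlieBracketWithin_univ] at h
  refine h.trans ?_
  change VectorField.lieBracketWithin ℝ (fun _ ↦ v) (fun _ ↦ w) Set.univ z = 0
  simp [VectorField.lieBracketWithin]

theorem isDiffFieldAt_constField (v z : EuclideanSpace ℝ (Fin n)) :
    AffineConnection.IsDiffFieldAt (constField v) z :=
  (contMDiffAt_vectorSpace_iff_contDiffAt.2
    (contDiffAt_const (n := 1) (c := v) (x := z))).mdifferentiableAt one_ne_zero

theorem coordFrame_eq_mpullback (hx : x ∈ (chartAt (EuclideanSpace ℝ (Fin n)) p).source)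
    (i : Fin n) :
    coordFrame p i x = VectorField.mpullback (𝓡 n) 𝓘(ℝ, EuclideanSpace ℝ (Fin n))
      (extChartAt (𝓡 n) p) (constField (EuclideanSpace.basisFun (Fin n) ℝ i)) x := by
  have : IsManifold (𝓡 n) 1 M := IsManifold.of_le (n := ∞) ENat.LEInfty.out
  have hinv := isInvertible_mfderiv_extChartAt (I := 𝓡 n) (x := p) (y := x) (by simpa using hx)
  rw [VectorField.mpullback_apply, eq_comm, hinv.inverse_apply_eq]
  exact (mfderiv_extChartAt_coordFrame hx i).symm

/-- The coordinate fields are pullbacks of constant fields under the chart, and pullback commutes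
with the bracket. -/
theorem mlieBracket_coordFrame (hx : x ∈ (chartAt (EuclideanSpace ℝ (Fin n)) p).source)
    (i j : Fin n) :
    VectorField.mlieBracket (𝓡 n) (coordFrame p i) (coordFrame p j) x = 0 := by
  have : IsManifold (𝓡 n) 1 M := IsManifold.of_le (n := ∞) ENat.LEInfty.out
  have := isManifold_minSmoothness (n := n) (M := M) (m := 2) ENat.LEInfty.out
  have := isManifold_minSmoothness (n := n) (M := M) (m := 3) ENat.LEInfty.out
  have ev (k : Fin n) : coordFrame p k =ᶠ[nhds x]
      VectorField.mpullback (𝓡 n) 𝓘(ℝ, EuclideanSpace ℝ (Fin n)) (extChartAt (𝓡 n) p)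
        (constField (EuclideanSpace.basisFun (Fin n) ℝ k)) :=
    Filter.eventually_of_mem ((chartAt _ p).open_source.mem_nhds hx)
      fun y hy ↦ coordFrame_eq_mpullback hy k
  rw [(ev i).mlieBracket_vectorField_eq (ev j), ← VectorField.mpullback_mlieBracket
    (isDiffFieldAt_constField _ _) (isDiffFieldAt_constField _ _)
    (contMDiffAt_extChartAt' (n := ∞) hx) (by simpa using ENat.LEInfty.out),
    VectorField.mpullback_apply, mlieBracket_constField, map_zero]

theorem contMDiffOn_coordCoeff {U : Set M} (hU : IsOpen U)
    (hUs : U ⊆ (chartAt (EuclideanSpace ℝ (Fin n)) p).source)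
    {Y : ∀ x : M, TangentSpace (𝓡 n) x} (hY : IsSmoothFieldOn U Y) (i : Fin n) :
    ContMDiffOn (𝓡 n) 𝓘(ℝ, ℝ) ∞ (fun x ↦ coordCoeff p i x (Y x)) U :=
  contMDiffOn_localFrameCoeff (e := chartTriv p) (EuclideanSpace.basisFun (Fin n) ℝ).toBasis hU hUs
    hY i

theorem mdifferentiableAt_coordCoeff
    (hx : x ∈ (chartAt (EuclideanSpace ℝ (Fin n)) p).source)
    {Y : ∀ x : M, TangentSpace (𝓡 n) x} (hY : AffineConnection.IsDiffFieldAt Y x) (i : Fin n) :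
    MDifferentiableAt (𝓡 n) 𝓘(ℝ, ℝ) (fun x ↦ coordCoeff p i x (Y x)) x :=
  mdifferentiableAt_localFrameCoeff (e := chartTriv p) (EuclideanSpace.basisFun (Fin n) ℝ).toBasis
    hx hY i

end CoordFrame

namespace AffineConnection

open SmoothVectorField

variable (nab : AffineConnection n M)

theorem nab_fun_sum {ι : Type*} {s : Finset ι} {σ : ι → ∀ x : M, TangentSpace (𝓡 n) x} {x : M}
    (hσ : ∀ i ∈ s, IsDiffFieldAt (σ i) x) :
    nab (fun y ↦ ∑ i ∈ s, σ i y) x = ∑ i ∈ s, nab (σ i) x := by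
  classical
  induction s using Finset.induction_on with
  | empty =>
    simp only [Finset.sum_empty]
    exact congrFun nab.zero x
  | insert a s ha ih =>
    have h₁ : IsDiffFieldAt (fun y ↦ ∑ i ∈ s, σ i y) x :=
      MDifferentiableAt.sum_section fun i hi ↦ hσ i (Finset.mem_insert_of_mem hi)
    simp only [Finset.sum_insert ha]
    rw [← ih fun i hi ↦ hσ i (Finset.mem_insert_of_mem hi)]
    exact nab.isCovariantDerivativeOn.add (s := Set.univ) (hσ a (Finset.mem_insert_self a s)) h₁

variable {nab} {p : M} {V : Set M} {F : Fin n → SmoothVectorField n M}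

/-- The covariant derivative of a vector field expressed in a coordinate frame. -/
theorem nab_eq_sum (hV : IsOpen V) (hVs : V ⊆ (chartAt (EuclideanSpace ℝ (Fin n)) p).source)
    (hF : ∀ i, ∀ x ∈ V, F i x = coordFrame p i x) {x : M} (hx : x ∈ V)
    {σ : ∀ x : M, TangentSpace (𝓡 n) x} (hσ : IsDiffFieldAt σ x) (v : TangentSpace (𝓡 n) x) :
    nab σ x v = ∑ j, (mvfderiv (𝓡 n) (fun y ↦ coordCoeff p j y (σ y)) x v • coordFrame p j x
      + coordCoeff p j x (σ x) • nab (F j) x v) := by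
  have hc (j : Fin n) := mdifferentiableAt_coordCoeff (hVs hx) hσ j
  have hd (j : Fin n) : IsDiffFieldAt ((fun y ↦ coordCoeff p j y (σ y)) • ⇑(F j)) x :=
    (hc j).smul_section (F j).mdifferentiableAt
  have ev : ∀ᶠ y in nhds x, σ y = ∑ j, ((fun y ↦ coordCoeff p j y (σ y)) • ⇑(F j)) y :=
    Filter.eventually_of_mem (hV.mem_nhds hx) fun y hy ↦ by
      simp only [Pi.smul_apply', hF _ y hy]
      exact coordFrame_linearCombination (hVs hy) (σ y)
  rw [nab.isCovariantDerivativeOn.congr_of_eventuallyEq (s := Set.univ) hσ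
    (MDifferentiableAt.sum_section fun j _ ↦ hd j) Filter.univ_mem ev, nab_fun_sum nab fun j _ ↦ hd j,
    sum_apply]
  refine Finset.sum_congr rfl fun j _ ↦ ?_
  rw [nab.isCovariantDerivativeOn.leibniz (s := Set.univ) (F j).mdifferentiableAt (hc j), ← hF j x hx]
  simp [add_comm]

variable (nab F p) in
/-- The connection form of the determinant bundle: the trace of `F_i ↦ ∇_v F_i`. -/
def traceForm (x : M) : TangentSpace (𝓡 n) x →ₗ[ℝ] ℝ :=
  ∑ i, coordCoeff p i x ∘ₗ (nab (F i) x).toLinearMap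

theorem traceForm_apply (x : M) (v : TangentSpace (𝓡 n) x) :
    traceForm nab p F x v = ∑ i, coordCoeff p i x (nab (F i) x v) := by
  simp [traceForm]

variable [CovariantDerivative.ContMDiffCovariantDerivative nab ∞]

theorem contMDiffOn_traceForm (hV : IsOpen V)
    (hVs : V ⊆ (chartAt (EuclideanSpace ℝ (Fin n)) p).source) (Y : SmoothVectorField n M) :
    ContMDiffOn (𝓡 n) 𝓘(ℝ, ℝ) ∞ (fun x ↦ traceForm nab p F x (Y x)) V := by
  simp only [traceForm_apply]
  exact contMDiffOn_finsetSum fun i _ ↦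
    contMDiffOn_coordCoeff hV hVs (covField nab Y (F i)).contMDiff.contMDiffOn i

/-- Expanding ∇_Y Fᵢ in the frame before applying ∇_X separates the derivative of the trace form
from the trace of a product of two connection matrices. -/
theorem trace_covField_covField (hV : IsOpen V)
    (hVs : V ⊆ (chartAt (EuclideanSpace ℝ (Fin n)) p).source)
    (hF : ∀ i, ∀ x ∈ V, F i x = coordFrame p i x) {x : M} (hx : x ∈ V)
    (X Y : SmoothVectorField n M) :
    ∑ i, coordCoeff p i x (covField nab X (covField nab Y (F i)) x) =
      mvfderiv (𝓡 n) (fun y ↦ traceForm nab p F y (Y y)) x (X x) +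
      ∑ i, ∑ j, coordCoeff p j x (nab (F i) x (Y x)) * coordCoeff p i x (nab (F j) x (X x)) := by
  simp only [traceForm_apply]
  have hm (i : Fin n) : MDifferentiableAt (𝓡 n) 𝓘(ℝ, ℝ)
      (fun y ↦ coordCoeff p i y (nab (F i) y (Y y))) x :=
    mdifferentiableAt_coordCoeff (p := p) (hVs hx) (covField nab Y (F i)).mdifferentiableAt i
  rw [mvfderiv_fun_sum fun i _ ↦ hm i, sum_apply, ← Finset.sum_add_distrib]
  refine Finset.sum_congr rfl fun i _ ↦ ?_
  rw [covField_apply, nab_eq_sum hV hVs hF hx (covField nab Y (F i)).mdifferentiableAt]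
  simp only [map_sum, map_add, map_smul, coordCoeff_coordFrame (hVs hx), Finset.sum_add_distrib,
    smul_eq_mul, mul_ite, mul_one, mul_zero, Finset.sum_ite_eq, Finset.mem_univ, if_true]
  rfl

/-- The trace of the curvature is the exterior derivative of the trace form. -/
theorem trace_curvature_eq (hV : IsOpen V)
    (hVs : V ⊆ (chartAt (EuclideanSpace ℝ (Fin n)) p).source)
    (hF : ∀ i, ∀ x ∈ V, F i x = coordFrame p i x) {x : M} (hx : x ∈ V)
    (X Y : SmoothVectorField n M) :
    ∑ i, coordCoeff p i x (curvature nab (F i) x (X x) (Y x)) =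
      mvfderiv (𝓡 n) (fun y ↦ traceForm nab p F y (Y y)) x (X x)
        - mvfderiv (𝓡 n) (fun y ↦ traceForm nab p F y (X y)) x (Y x)
        - traceForm nab p F x (bracket X Y x) := by
  -- The trace of a product does not see the order of the factors, so this term cancels in the
  -- curvature.
  have hc : ∑ i, ∑ j, coordCoeff p j x (nab (F i) x (Y x)) * coordCoeff p i x (nab (F j) x (X x)) =
      ∑ i, ∑ j, coordCoeff p j x (nab (F i) x (X x)) * coordCoeff p i x (nab (F j) x (Y x)) := by
    rw [Finset.sum_comm]
    exact Finset.sum_congr rfl fun i _ ↦ Finset.sum_congr rfl fun j _ ↦ mul_comm _ _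
  have h₁ := trace_covField_covField (nab := nab) hV hVs hF hx X Y
  have h₂ := trace_covField_covField (nab := nab) hV hVs hF hx Y X
  have h₃ := traceForm_apply (nab := nab) (p := p) (F := F) x (bracket X Y x)
  have h₄ (i : Fin n) : coordCoeff p i x (curvature nab (F i) x (X x) (Y x)) =
      coordCoeff p i x (covField nab X (covField nab Y (F i)) x)
      - coordCoeff p i x (covField nab Y (covField nab X (F i)) x)
      - coordCoeff p i x (nab (F i) x (bracket X Y x)) := by
    rw [curvature_eq, map_sub, map_sub]
    rfl
  rw [Finset.sum_congr rfl fun i _ ↦ h₄ i, Finset.sum_sub_distrib, Finset.sum_sub_distrib, h₁, h₂,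
    h₃, hc]
  ring

end AffineConnection

end

/-! ### Determinant identities and the Poincaré lemma. -/

noncomputable section

theorem Matrix.det_updateRow_eq_sum {ι R : Type*} [Fintype ι] [DecidableEq ι] [CommRing R]
    (A : Matrix ι ι R) (i : ι) (v : ι → R) :
    (A.updateRow i v).det = ∑ j, v j * A.adjugate j i := by
  rw [← Matrix.cramer_transpose_apply, Matrix.cramer_eq_adjugate_mulVec, ← Matrix.adjugate_transpose]
  simp [Matrix.mulVec, dotProduct, mul_comm]

/-- Laplace expansion along each replaced row gives tr(A B adj A), and adj A · A = det A. With A the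
coefficients of the Yᵢ and B the connection matrix, this is the connection part of ∑ᵢ vol(…, ∇_v Yᵢ,
…). -/
theorem Matrix.sum_det_updateRow_mul {ι R : Type*} [Fintype ι] [DecidableEq ι] [CommRing R]
    (A B : Matrix ι ι R) : ∑ i, (A.updateRow i ((A * B) i)).det = B.trace * A.det := by
  have h : ∑ i, (A.updateRow i ((A * B) i)).det = (A * B * A.adjugate).trace := by
    simp only [Matrix.det_updateRow_eq_sum, Matrix.trace, Matrix.diag, Matrix.mul_apply (M := A * B)]
  rw [h, Matrix.trace_mul_comm, ← Matrix.mul_assoc, Matrix.adjugate_mul]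
  simp [mul_comm]

/-- The determinant as a continuous multilinear map of the rows. -/
def detRowCLM (n : ℕ) : ContinuousMultilinearMap ℝ (fun _ : Fin n ↦ Fin n → ℝ) ℝ where
  toMultilinearMap := (Matrix.detRowAlternating (R := ℝ) (n := Fin n)).toMultilinearMap
  cont := Continuous.matrix_det continuous_id

theorem mvfderiv_apply_eq_fderiv {E F : Type*} [NormedAddCommGroup E] [NormedSpace ℝ E]
    [NormedAddCommGroup F] [NormedSpace ℝ F] (h : E → F) (z : E) (v : TangentSpace 𝓘(ℝ, E) z) :
    mvfderiv 𝓘(ℝ, E) h z v = fderiv ℝ h z (NormedSpace.fromTangentSpace z v) := by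
  rw [mvfderiv, mfderiv_eq_fderiv]
  rfl

section

variable {n : ℕ} {M : Type*} [TopologicalSpace M] [ChartedSpace (EuclideanSpace ℝ (Fin n)) M]

/-- The determinant is multilinear in the rows, so its derivative replaces one row at a time. -/
theorem mvfderiv_det {A : M → Fin n → Fin n → ℝ} {x : M}
    (hA : ∀ i j, ContMDiffAt (𝓡 n) 𝓘(ℝ, ℝ) 1 (fun y ↦ A y i j) x)
    (v : TangentSpace (𝓡 n) x) :
    MDifferentiableAt (𝓡 n) 𝓘(ℝ, ℝ) (fun y ↦ (Matrix.of (A y)).det) x ∧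
    mvfderiv (𝓡 n) (fun y ↦ (Matrix.of (A y)).det) x v =
      ∑ i, ((Matrix.of (A x)).updateRow i
        (fun j ↦ mvfderiv (𝓡 n) (fun y ↦ A y i j) x v)).det := by
  have hA' : MDifferentiableAt (𝓡 n) 𝓘(ℝ, Fin n → Fin n → ℝ) A x :=
    (contMDiffAt_pi_space.2 fun i ↦ contMDiffAt_pi_space.2 fun j ↦ hA i j).mdifferentiableAt
      one_ne_zero
  have hdet : MDifferentiableAt 𝓘(ℝ, Fin n → Fin n → ℝ) 𝓘(ℝ, ℝ) (detRowCLM n) (A x) :=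
    ((detRowCLM n).hasFDerivAt (A x)).differentiableAt.mdifferentiableAt
  refine ⟨hdet.comp x hA', ?_⟩
  have hc (i j : Fin n) : mvfderiv (𝓡 n) (fun y ↦ A y i j) x v =
      (mvfderiv (𝓡 n) A x v) i j := by
    let L : (Fin n → Fin n → ℝ) →L[ℝ] ℝ :=
      (ContinuousLinearMap.proj (R := ℝ) (φ := fun _ : Fin n ↦ ℝ) j).comp
        (ContinuousLinearMap.proj (R := ℝ) (φ := fun _ : Fin n ↦ Fin n → ℝ) i)
    have := mvfderiv_comp_apply x (g := L) L.differentiableAt.mdifferentiableAt hA' v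
    refine this.trans ?_
    rw [mvfderiv_apply_eq_fderiv, L.fderiv]
    rfl
  have := mvfderiv_comp_apply x (g := detRowCLM n) hdet hA' v
  refine this.trans ?_
  rw [mvfderiv_apply_eq_fderiv, ((detRowCLM n).hasFDerivAt (A x)).fderiv]
  refine ((detRowCLM n).linearDeriv_apply (A x) (mvfderiv (𝓡 n) A x v)).trans ?_
  refine Finset.sum_congr rfl fun i _ ↦ ?_
  rw [show (fun j ↦ mvfderiv (𝓡 n) (fun y ↦ A y i j) x v) = mvfderiv (𝓡 n) A x v i from
    funext (hc i)]
  rfl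

theorem contMDiffOn_det {A : M → Fin n → Fin n → ℝ} {U : Set M}
    (hA : ∀ i j, ContMDiffOn (𝓡 n) 𝓘(ℝ, ℝ) ∞ (fun y ↦ A y i j) U) :
    ContMDiffOn (𝓡 n) 𝓘(ℝ, ℝ) ∞ (fun y ↦ (Matrix.of (A y)).det) U :=
  (detRowCLM n).contDiff.contMDiff.comp_contMDiffOn
    (contMDiffOn_pi_space.2 fun i ↦ contMDiffOn_pi_space.2 fun j ↦ hA i j)

end

/-- The Poincaré lemma for 1-forms `∑ t_k dx_k`, near a point. -/
theorem exists_contDiffOn_primitive {n : ℕ} {W : Set (EuclideanSpace ℝ (Fin n))} (hW : IsOpen W)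
    {z₀ : EuclideanSpace ℝ (Fin n)} (hz₀ : z₀ ∈ W) {t : Fin n → EuclideanSpace ℝ (Fin n) → ℝ}
    (ht : ∀ k, ContDiffOn ℝ ∞ (t k) W)
    (hsymm : ∀ z ∈ W, ∀ j k, fderiv ℝ (t k) z (EuclideanSpace.basisFun (Fin n) ℝ j) =
      fderiv ℝ (t j) z (EuclideanSpace.basisFun (Fin n) ℝ k)) :
    ∃ B : Set (EuclideanSpace ℝ (Fin n)), IsOpen B ∧ z₀ ∈ B ∧ B ⊆ W ∧
      ∃ f : EuclideanSpace ℝ (Fin n) → ℝ, ContDiffOn ℝ ∞ f B ∧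
        ∀ z ∈ B, ∀ v, fderiv ℝ f z v = ∑ k, t k z * v k := by
  obtain ⟨r, hr, hB⟩ := Metric.isOpen_iff.1 hW z₀ hz₀
  -- A ball is convex, so a closed form on it has a primitive.
  refine ⟨Metric.ball z₀ r, Metric.isOpen_ball, Metric.mem_ball_self hr, hB, ?_⟩
  let η : EuclideanSpace ℝ (Fin n) → EuclideanSpace ℝ (Fin n) →L[ℝ] ℝ :=
    fun z ↦ ∑ k, t k z • EuclideanSpace.proj k
  have hη : ContDiffOn ℝ ∞ η (Metric.ball z₀ r) :=
    ContDiffOn.sum fun k _ ↦ ((ht k).mono hB).smul contDiffOn_const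
  have hd {z} (hz : z ∈ W) (k : Fin n) : DifferentiableAt ℝ (t k) z :=
    ((ht k).contDiffAt (hW.mem_nhds hz)).differentiableAt (by simp)
  have hfd {z} (hz : z ∈ W) (u v : EuclideanSpace ℝ (Fin n)) :
      fderiv ℝ η z u v = ∑ k, ∑ j, u j * v k *
        fderiv ℝ (t k) z (EuclideanSpace.basisFun (Fin n) ℝ j) := by
    have h : HasFDerivAt η (∑ k, (fderiv ℝ (t k) z).smulRight
        (EuclideanSpace.proj k : EuclideanSpace ℝ (Fin n) →L[ℝ] ℝ)) z :=
      HasFDerivAt.fun_sum fun k _ ↦ (hd hz k).hasFDerivAt.smul_const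
        (EuclideanSpace.proj k : EuclideanSpace ℝ (Fin n) →L[ℝ] ℝ)
    rw [h.fderiv]
    simp only [sum_apply, ContinuousLinearMap.smulRight_apply, smul_apply]
    refine Finset.sum_congr rfl fun k _ ↦ ?_
    conv_lhs => rw [← (EuclideanSpace.basisFun (Fin n) ℝ).sum_repr u]
    simp only [map_sum, map_smul, EuclideanSpace.basisFun_repr, smul_eq_mul,
      PiLp.proj_apply, Finset.sum_mul]
    exact Finset.sum_congr rfl fun j _ ↦ by ring
  obtain ⟨f, hf⟩ := (convex_ball z₀ r).exists_forall_hasFDerivAt_of_fderiv_symmetric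
    Metric.isOpen_ball (hη.differentiableOn (by simp)) (fun z hz u v ↦ by
      rw [hfd (hB hz), hfd (hB hz), Finset.sum_comm]
      refine Finset.sum_congr rfl fun j _ ↦ Finset.sum_congr rfl fun k _ ↦ ?_
      rw [hsymm z (hB hz) j k]
      ring)
  refine ⟨f, ?_, fun z hz v ↦ ?_⟩
  -- The primitive is smooth because its derivative is the smooth form η.
  · rw [contDiffOn_infty_iff_fderiv_of_isOpen Metric.isOpen_ball]
    exact ⟨fun z hz ↦ (hf z hz).differentiableAt.differentiableWithinAt,
      hη.congr fun z hz ↦ (hf z hz).fderiv⟩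
  · rw [(hf z hz).fderiv]
    simp [η]

end

/-! ### Local primitive of the trace form and the parallel volume form. -/

noncomputable section

variable {n : ℕ} {M : Type*} [TopologicalSpace M]
  [ChartedSpace (EuclideanSpace ℝ (Fin n)) M] [IsManifold (𝓡 n) ∞ M]

/-- The chain rule for functions of the coordinates of the chart at `p`. -/
theorem mvfderiv_comp_extChartAt {p x : M}
    (hx : x ∈ (chartAt (EuclideanSpace ℝ (Fin n)) p).source) {h : EuclideanSpace ℝ (Fin n) → ℝ}
    (hh : DifferentiableAt ℝ h (extChartAt (𝓡 n) p x)) (v : TangentSpace (𝓡 n) x) :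
    mvfderiv (𝓡 n) (fun y ↦ h (extChartAt (𝓡 n) p y)) x v =
      fderiv ℝ h (extChartAt (𝓡 n) p x)
        (∑ i, coordCoeff p i x v • EuclideanSpace.basisFun (Fin n) ℝ i) := by
  have : IsManifold (𝓡 n) 1 M := IsManifold.of_le (n := ∞) ENat.LEInfty.out
  refine (mvfderiv_comp_apply x (g := h) hh.mdifferentiableAt
    (mdifferentiableAt_extChartAt hx) v).trans ?_
  rw [mvfderiv_apply_eq_fderiv, mfderiv_extChartAt_apply hx]
  rfl

namespace AffineConnection

open SmoothVectorField

variable {nab : AffineConnection n M} {p : M} {V : Set M} {F : Fin n → SmoothVectorField n M}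

section Closed

variable [CovariantDerivative.ContMDiffCovariantDerivative nab ∞]

/-- This is closedness of the trace form on coordinate fields: symmetry of Ric kills tr R, and the
bracket term vanishes because coordinate fields commute. -/
theorem mvfderiv_traceForm_comm (hV : IsOpen V)
    (hVs : V ⊆ (chartAt (EuclideanSpace ℝ (Fin n)) p).source)
    (hF : ∀ i, ∀ x ∈ V, F i x = coordFrame p i x)
    (ht : nab.IsTorsionFree) (hRic : IsRicciSymmetric nab) {x : M} (hx : x ∈ V) (j k : Fin n) :
    mvfderiv (𝓡 n) (fun y ↦ traceForm nab p F y (F k y)) x (F j x) =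
      mvfderiv (𝓡 n) (fun y ↦ traceForm nab p F y (F j y)) x (F k x) := by
  have hx' : x ∈ (chartTriv (n := n) p).baseSet := hVs hx
  have hb : bracket (F j) (F k) x = 0 := by
    have ev (i : Fin n) : ⇑(F i) =ᶠ[nhds x] coordFrame p i :=
      Filter.eventually_of_mem (hV.mem_nhds hx) (hF i)
    rw [bracket_apply, (ev j).mlieBracket_vectorField_eq (ev k), mlieBracket_coordFrame (hVs hx)]
  have h := trace_curvature_eq (nab := nab) hV hVs hF hx (F j) (F k)
  have hr := ht.ricci_sub_ricci (F j) (F k)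
    ((chartTriv p).basisAt (EuclideanSpace.basisFun (Fin n) ℝ).toBasis hx') F
    (fun i ↦ by rw [hF i x hx]; exact Trivialization.localFrame_apply_of_mem_baseSet _ _ hx')
  rw [hRic (F j) (F k) x, sub_self, zero_eq_neg] at hr
  have hs : ∑ i, coordCoeff p i x (curvature nab (F i) x (F j x) (F k x)) = 0 := by
    rw [← hr]
    refine Finset.sum_congr rfl fun i _ ↦ ?_
    classical
    simpa using (chartTriv p).localFrameCoeff_apply_of_mem_baseSet (I := 𝓡 n)
      (b := (EuclideanSpace.basisFun (Fin n) ℝ).toBasis) hx'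
      (Function.update 0 x (curvature nab (F i) x (F j x) (F k x))) i
  rw [hs, hb, map_zero] at h
  linarith

/-- If the Ricci tensor is symmetric, the trace form has local primitives. -/
theorem exists_primitive_traceForm (hV : IsOpen V) (hpV : p ∈ V)
    (hVs : V ⊆ (chartAt (EuclideanSpace ℝ (Fin n)) p).source)
    (hF : ∀ i, ∀ x ∈ V, F i x = coordFrame p i x)
    (ht : nab.IsTorsionFree) (hRic : IsRicciSymmetric nab) :
    ∃ U : Set M, IsOpen U ∧ p ∈ U ∧ U ⊆ V ∧ ∃ f : M → ℝ, ContMDiffOn (𝓡 n) 𝓘(ℝ, ℝ) ∞ f U ∧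
      ∀ x ∈ U, ∀ v, mvfderiv (𝓡 n) f x v = traceForm nab p F x v := by
  set φ := extChartAt (𝓡 n) p with hφ
  have hsrc : φ.source = (chartAt (EuclideanSpace ℝ (Fin n)) p).source := extChartAt_source _ p
  let W := φ.target ∩ φ.symm ⁻¹' V
  have hW : IsOpen W :=
    (continuousOn_extChartAt_symm p).isOpen_inter_preimage (isOpen_extChartAt_target p) hV
  -- Components of the trace form, read in the chart.
  let t (k : Fin n) (z : EuclideanSpace ℝ (Fin n)) : ℝ :=
    traceForm nab p F (φ.symm z) (F k (φ.symm z))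
  have htc (k : Fin n) : ContDiffOn ℝ ∞ (t k) W := by
    rw [← contMDiffOn_iff_contDiffOn]
    exact (contMDiffOn_traceForm hV hVs (F k)).comp
      ((contMDiffOn_extChartAt_symm p).mono Set.inter_subset_left) Set.inter_subset_right
  have htd (k : Fin n) {z} (hz : z ∈ W) : DifferentiableAt ℝ (t k) z :=
    ((htc k).contDiffAt (hW.mem_nhds hz)).differentiableAt (by simp)
  have hφW {x : M} (hx : x ∈ V) : φ x ∈ W :=
    ⟨φ.map_source (hsrc ▸ hVs hx), by simpa [φ.left_inv (hsrc ▸ hVs hx)] using hx⟩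
  have htf {x : M} (hx : x ∈ V) (j k : Fin n) :
      fderiv ℝ (t k) (φ x) (EuclideanSpace.basisFun (Fin n) ℝ j) =
        mvfderiv (𝓡 n) (fun y ↦ traceForm nab p F y (F k y)) x (F j x) := by
    have ev : (fun y ↦ traceForm nab p F y (F k y)) =ᶠ[nhds x] fun y ↦ t k (φ y) :=
      Filter.eventually_of_mem (hV.mem_nhds hx) fun y hy ↦ by
        simp only [t]
        rw [φ.left_inv (hsrc ▸ hVs hy)]
    have h₁ : mvfderiv (𝓡 n) (fun y ↦ traceForm nab p F y (F k y)) x (F j x) =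
        mvfderiv (𝓡 n) (fun y ↦ t k (φ y)) x (F j x) := by
      simp only [mvfderiv]
      rw [ev.mfderiv_eq]
      rfl
    rw [h₁, mvfderiv_comp_extChartAt (hVs hx) (htd k (hφW hx)), hF j x hx]
    simp only [coordCoeff_coordFrame (hVs hx), ite_smul, one_smul, zero_smul, Finset.sum_ite_eq',
      Finset.mem_univ, if_true, hφ]
  obtain ⟨B, hB, hpB, hBW, f, hf, hfd⟩ := exists_contDiffOn_primitive hW (hφW hpV) htc
    (fun z hz j k ↦ by
      have := mvfderiv_traceForm_comm hV hVs hF ht hRic hz.2 j k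
      rw [← htf hz.2, ← htf hz.2, φ.right_inv hz.1] at this
      exact this)
  have hUo : IsOpen (φ.source ∩ φ ⁻¹' B) :=
    (continuousOn_extChartAt p).isOpen_inter_preimage (isOpen_extChartAt_source p) hB
  have hUV : φ.source ∩ φ ⁻¹' B ⊆ V := fun x hx ↦ by
    have := (hBW hx.2).2
    rwa [Set.mem_preimage, φ.left_inv hx.1] at this
  refine ⟨φ.source ∩ φ ⁻¹' B, hUo, ⟨mem_extChartAt_source p, hpB⟩, hUV, fun y ↦ f (φ y), ?_, ?_⟩
  · exact hf.contMDiffOn.comp ((contMDiffOn_extChartAt (I := 𝓡 n) (x := p)).mono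
      fun x hx ↦ hsrc ▸ hx.1) fun x hx ↦ hx.2
  · intro x hx v
    have hxs : x ∈ (chartAt (EuclideanSpace ℝ (Fin n)) p).source := hsrc ▸ hx.1
    rw [mvfderiv_comp_extChartAt hxs
      ((hf.contDiffAt (hB.mem_nhds hx.2)).differentiableAt (by simp)), hfd _ hx.2]
    conv_rhs => rw [coordFrame_linearCombination hxs v]
    rw [map_sum]
    refine Finset.sum_congr rfl fun k _ ↦ ?_
    have : t k (φ x) = traceForm nab p F x (coordFrame p k x) := by
      simp only [t]
      rw [φ.left_inv hx.1, hF k x (hUV hx)]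
    rw [this, map_smul, smul_eq_mul, mul_comm]
    congr 1
    simp [Pi.single_apply]

end Closed

/-- The volume form `e^f dx₁ ∧ ⋯ ∧ dxₙ` in the chart at `p`. -/
def coordVol (p : M) (f : M → ℝ) (x : M) : TangentSpace (𝓡 n) x [⋀^Fin n]→ₗ[ℝ] ℝ :=
  Real.exp (f x) • (Matrix.detRowAlternating (R := ℝ) (n := Fin n)).compLinearMap
    (LinearMap.pi fun i ↦ coordCoeff p i x)

theorem coordVol_apply (f : M → ℝ) (x : M) (Y : Fin n → TangentSpace (𝓡 n) x) :
    coordVol p f x Y =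
      Real.exp (f x) * (Matrix.of fun i j ↦ coordCoeff p j x (Y i)).det := rfl

theorem isVolumeFormOn_coordVol {U : Set M} (hU : IsOpen U)
    (hUs : U ⊆ (chartAt (EuclideanSpace ℝ (Fin n)) p).source) {f : M → ℝ}
    (hf : ContMDiffOn (𝓡 n) 𝓘(ℝ, ℝ) ∞ f U) : IsVolumeFormOn (n := n) U (coordVol p f) where
  smooth Y hY := by
    simp only [coordVol_apply]
    exact (Real.contDiff_exp.contMDiff.comp_contMDiffOn hf).mul
      (contMDiffOn_det fun i j ↦ contMDiffOn_coordCoeff hU hUs (hY i) j)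
  ne_zero x hx h := by
    have h₁ := congrArg (fun w ↦ w (fun i ↦ coordFrame p i x)) h
    simp only [coordVol_apply, coordCoeff_coordFrame (hUs hx)] at h₁
    have : (Matrix.of fun i j : Fin n ↦ if j = i then (1 : ℝ) else 0) = 1 := by
      ext i j
      simp [Matrix.one_apply, eq_comm]
    rw [this, Matrix.det_one, mul_one] at h₁
    exact (Real.exp_pos _).ne' h₁

/-- In coordinates ∇_v Yᵢ has components DA + AB, where A holds the components of the Yᵢ, DA their
derivatives and B the connection matrix. The DA terms cancel against the derivative of det A; the AB
terms sum to tr B · det A, which the derivative of e^f compensates since tr B = df(v). -/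
theorem isParallelOn_coordVol (hV : IsOpen V)
    (hVs : V ⊆ (chartAt (EuclideanSpace ℝ (Fin n)) p).source)
    (hF : ∀ i, ∀ x ∈ V, F i x = coordFrame p i x) {U : Set M} (hU : IsOpen U) (hUV : U ⊆ V)
    {f : M → ℝ} (hf : ContMDiffOn (𝓡 n) 𝓘(ℝ, ℝ) ∞ f U)
    (hfd : ∀ x ∈ U, ∀ v, mvfderiv (𝓡 n) f x v = traceForm nab p F x v) :
    IsParallelOn nab U (coordVol p f) := by
  intro Y hY x hx v
  have hxs := hVs (hUV hx)
  let A (y : M) (i j : Fin n) : ℝ := coordCoeff p j y (Y i y)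
  let DA (i j : Fin n) : ℝ := mvfderiv (𝓡 n) (fun y ↦ A y i j) x v
  let B : Matrix (Fin n) (Fin n) ℝ := .of fun k j ↦ coordCoeff p j x (nab (F k) x v)
  have hYd (i : Fin n) : IsDiffFieldAt (Y i) x :=
    ((hY i).contMDiffAt (hU.mem_nhds hx)).mdifferentiableAt (by simp)
  have hA (i j : Fin n) : ContMDiffAt (𝓡 n) 𝓘(ℝ, ℝ) 1 (fun y ↦ A y i j) x :=
    ((contMDiffOn_coordCoeff hU (hUV.trans hVs) (hY i) j).contMDiffAt (hU.mem_nhds hx)).of_le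
      ENat.LEInfty.out
  obtain ⟨hdet, hdet'⟩ := mvfderiv_det hA v
  have hfx : MDifferentiableAt (𝓡 n) 𝓘(ℝ, ℝ) f x :=
    (hf.contMDiffAt (hU.mem_nhds hx)).mdifferentiableAt (by simp)
  have hexp : MDifferentiableAt 𝓘(ℝ, ℝ) 𝓘(ℝ, ℝ) Real.exp (f x) :=
    Real.differentiableAt_exp.mdifferentiableAt
  have hexp' : mvfderiv (𝓡 n) (fun y ↦ Real.exp (f y)) x v =
      Real.exp (f x) * mvfderiv (𝓡 n) f x v := by
    refine (mvfderiv_comp_apply x hexp hfx v).trans ?_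
    rw [mvfderiv_apply_eq_fderiv, (Real.hasDerivAt_exp (f x)).hasFDerivAt.fderiv]
    exact mul_comm _ _
  have hcoef (i j : Fin n) : coordCoeff p j x (nab (Y i) x v) = DA i j + (Matrix.of (A x) * B) i j := by
    rw [nab_eq_sum hV hVs hF (hUV hx) (hYd i)]
    simp only [map_sum, map_add, map_smul, coordCoeff_coordFrame hxs, Finset.sum_add_distrib,
      smul_eq_mul, mul_ite, mul_one, mul_zero, Finset.sum_ite_eq, Finset.mem_univ, if_true,
      Matrix.mul_apply]
    rfl
  have hupd (i : Fin n) :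
      coordVol p f x (Function.update (fun j ↦ Y j x) i (nab (Y i) x v)) =
        Real.exp (f x) * (((Matrix.of (A x)).updateRow i (DA i)).det +
          ((Matrix.of (A x)).updateRow i ((Matrix.of (A x) * B) i)).det) := by
    rw [coordVol_apply, ← Matrix.det_updateRow_add]
    congr 2
    ext k j
    by_cases hk : k = i
    · subst hk
      simp [hcoef]
    · simp [hk, A]
  have htr : B.trace = mvfderiv (𝓡 n) f x v := by
    rw [hfd x hx, traceForm_apply]
    rfl
  rw [covDerivForm, Finset.sum_congr rfl fun i _ ↦ hupd i, ← Finset.mul_sum, Finset.sum_add_distrib,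
    Matrix.sum_det_updateRow_mul, htr]
  have hmul := mvfderiv_fun_mul (I := 𝓡 n) (f := fun y ↦ Real.exp (f y))
    (g := fun y ↦ (Matrix.of (A y)).det) (x := x) (hexp.comp x hfx) hdet
  have hvol : mvfderiv (𝓡 n) (fun y ↦ coordVol p f y (fun i ↦ Y i y)) x v =
      Real.exp (f x) * ∑ i, ((Matrix.of (A x)).updateRow i (DA i)).det +
        (Matrix.of (A x)).det * (Real.exp (f x) * mvfderiv (𝓡 n) f x v) := by
    rw [← hexp', ← hdet']
    exact DFunLike.congr_fun hmul v
  rw [hvol]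
  ring

/-- A torsion-free connection with symmetric Ricci tensor is locally equiaffine. -/
theorem IsRicciSymmetric.isEquiaffine [T2Space M]
    [CovariantDerivative.ContMDiffCovariantDerivative nab ∞]
    (hRic : IsRicciSymmetric nab) (ht : nab.IsTorsionFree) : IsEquiaffine nab := by
  intro p
  obtain ⟨V, hV, hpV, hVs, F, hF⟩ := exists_smoothVectorField_eq_coordFrame (n := n) p
  obtain ⟨U, hU, hpU, hUV, f, hf, hfd⟩ := exists_primitive_traceForm hV hpV hVs hF ht hRic
  exact ⟨U, hU, hpU, coordVol p f, isVolumeFormOn_coordVol hU (hUV.trans hVs) hf,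
    isParallelOn_coordVol hV hVs hF hU hUV hf hfd⟩

end AffineConnection

end

theorem theorem3p1 {n : ℕ} {M : Type*} [TopologicalSpace M] [T2Space M]
    [ChartedSpace (EuclideanSpace ℝ (Fin n)) M] [IsManifold (𝓡 n) ∞ M]
    (g : SmoothMetric n M) (nab nabS : AffineConnection n M)
    [CovariantDerivative.ContMDiffCovariantDerivative nab ∞]
    [CovariantDerivative.ContMDiffCovariantDerivative nabS ∞]
    (hstat : AffineConnection.IsStatistical g nab)
    (hdual : AffineConnection.IsDual g nab nabS)
    (hRic : AffineConnection.IsConjugateRicciSymmetric nab nabS) :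
    AffineConnection.IsRicciSymmetric nab ∧ AffineConnection.IsEquiaffine nab := by
  have ht := AffineConnection.isTorsionFree_of_torsion_eq_zero nab hstat.torsion_free
  have hsymm := hRic.isRicciSymmetric ht (hstat.isTorsionFree_dual hdual) hdual
  exact ⟨hsymm, hsymm.isEquiaffine ht⟩
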